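/- Let $G$ be a finite simple graph of order $n>2$ with $m$ edges, and let $\mu_1(G)\ge\mu_2(G)\ge\cdots\ge\mu_n(G)=0$ be the eigenvalues, counted with multiplicity, of its Laplacian matrix $L(G)=D(G)-A(G)$, where $D(G)$ is the diagonal matrix of vertex degrees and $A(G)$ is the adjacency matrix. Write $K_{a,b}$ for the complete bipartite graph with parts of sizes $a$ and $b$, $\cup$ for the vertex-disjoint union of graphs, and $rK_1$ for the graph with $r$ vertices and no edges. Suppose that $G$ is not isomorphic to $K_{1,n-r-1}\cup rK_1$ for any integer $r$ with $0\le r\le\lceil n/2\rceil-2$ or $r=n-2$. Then $$\mu_2(G)\ge\frac{2m}{n}.$$ Moreover, equality holds if and only if $G\cong nK_1$, or $n$ is even and $G\cong K_{n/2,n/2}$, or $n$ is even and $G\cong K_{1,n/2}\cup(n/2-1)K_1$. -/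

import Mathlib

/-- The graph `K_{1,s} ∪ r K_1`: the vertex-disjoint union of a star with `s` leaves and
`r` isolated vertices. -/
abbrev starUnionIsolated (s r : ℕ) : SimpleGraph ((Fin 1 ⊕ Fin s) ⊕ Fin r) :=
  completeBipartiteGraph (Fin 1) (Fin s) ⊕g (⊥ : SimpleGraph (Fin r))

/-- The second largest eigenvalue, counted with multiplicity, of the Laplacian matrix `D - A` of
a finite simple graph with at least two vertices. (`eigenvalues₀` lists the eigenvalues
in nonincreasing order, starting at index `0`.) -/
noncomputable def laplacianSecond {V : Type*} [Fintype V] [DecidableEq V]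
    (G : SimpleGraph V) [DecidableRel G.Adj] (hV : 1 < Fintype.card V) : ℝ :=
  (G.isHermitian_lapMatrix ℝ).eigenvalues₀ ⟨1, hV⟩

/-
By Courant–Fischer, `c < μ₂` as soon as the form `x ↦ xᵀLx - c|x|²` is positive definite on some
plane. Take `c` slightly below the average degree `d = 2m/n`, or equal to it.

Two vertices `u`, `v` of degree at least `c` give such a plane: the span of `e_u` and `e_v` if they
are not adjacent, and test vectors supported on a double star with centres `u`, `v` if they are.
For a single vertex `v` of degree above `d`, let `k = ⌊d⌋` bound the other degrees. The plane
spanned by `e_v` and the column `L e_c` works for any `c` of degree `k` not adjacent to `v`, and the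
plane spanned by `e_v` and `e_a - e_b` works for an edge `ab` with `deg a + deg b + 2 > 2d` whose
ends are both adjacent or both nonadjacent to `v`. If no such plane exists and `k ≥ 2`, counting the
edges that meet the neighbours of `v` of degree `k` gives `d < k`, a contradiction; if `k ≤ 1`, then
every edge contains `v`. If no degree exceeds `d`, then `G` is regular, and two edges `ab`, `cd`
give the plane of `e_a - e_b` and `e_c - e_d`, unless `G` is edgeless or complete bipartite. What
remains are stars with isolated vertices, where `μ₂ = 1`.
-/

open Finset Matrix Module

section CourantFischer

variable {E : Type*} [NormedAddCommGroup E] [InnerProductSpace ℝ E]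

theorem exists_mem_ne_zero_forall_inner_eq_zero {ι : Type*} (W : Submodule ℝ E)
    [FiniteDimensional ℝ W] (e : ι → E) (J : Finset ι) (hJ : #J < finrank ℝ W) :
    ∃ x ∈ W, x ≠ 0 ∧ ∀ j ∈ J, inner ℝ (e j) x = 0 := by
  let f : W →ₗ[ℝ] J → ℝ := LinearMap.pi fun j => (innerₛₗ ℝ (e j)).comp W.subtype
  have hf : finrank ℝ (J → ℝ) < finrank ℝ W := by simpa using hJ
  obtain ⟨x, hx, hx0⟩ := (Submodule.ne_bot_iff _).1 (LinearMap.ker_ne_bot_of_finrank_lt (f := f) hf)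
  exact ⟨x, x.2, by simpa using hx0, fun j hj => congrFun (LinearMap.mem_ker.1 hx) ⟨j, hj⟩⟩

variable [FiniteDimensional ℝ E] {T : E →ₗ[ℝ] E} (hT : T.IsSymmetric) {N : ℕ}
  (hN : finrank ℝ E = N)

include hT

theorem inner_apply_self_eq_sum_eigenvalues (x : E) :
    inner ℝ x (T x) = ∑ i, hT.eigenvalues hN i * inner ℝ (hT.eigenvectorBasis hN i) x ^ 2 := by
  rw [← (hT.eigenvectorBasis hN).sum_inner_mul_inner x (T x)]
  refine sum_congr rfl fun i _ => ?_
  rw [← hT, hT.apply_eigenvectorBasis, real_inner_smul_left, real_inner_comm x,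
    RCLike.ofReal_real_eq_id, id]
  ring

theorem exists_mem_inner_apply_self_le (W : Submodule ℝ E) (i : Fin N) (hi : i < finrank ℝ W) :
    ∃ x ∈ W, x ≠ 0 ∧ inner ℝ x (T x) ≤ hT.eigenvalues hN i * inner ℝ x x := by
  obtain ⟨x, hxW, hx0, hx⟩ := exists_mem_ne_zero_forall_inner_eq_zero W (hT.eigenvectorBasis hN)
    (Iio i) (by simpa using hi)
  refine ⟨x, hxW, hx0, ?_⟩
  rw [inner_apply_self_eq_sum_eigenvalues hT hN, real_inner_self_eq_norm_sq,
    ← (hT.eigenvectorBasis hN).sum_sq_inner_right, mul_sum]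
  refine sum_le_sum fun j _ => ?_
  rcases lt_or_ge j i with hji | hij
  · rw [hx j (mem_Iio.2 hji)]
    simp
  · exact mul_le_mul_of_nonneg_right (hT.eigenvalues_antitone hN hij) (sq_nonneg _)

theorem exists_mem_le_inner_apply_self (W : Submodule ℝ E) (i : Fin N)
    (hi : N ≤ finrank ℝ W + i) :
    ∃ x ∈ W, x ≠ 0 ∧ hT.eigenvalues hN i * inner ℝ x x ≤ inner ℝ x (T x) := by
  obtain ⟨x, hxW, hx0, hx⟩ := exists_mem_ne_zero_forall_inner_eq_zero W (hT.eigenvectorBasis hN)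
    (Ioi i) (by rw [Fin.card_Ioi]; omega)
  refine ⟨x, hxW, hx0, ?_⟩
  rw [inner_apply_self_eq_sum_eigenvalues hT hN, real_inner_self_eq_norm_sq,
    ← (hT.eigenvectorBasis hN).sum_sq_inner_right, mul_sum]
  refine sum_le_sum fun j _ => ?_
  rcases lt_or_ge i j with hij | hji
  · rw [hx j (mem_Ioi.2 hij)]
    simp
  · exact mul_le_mul_of_nonneg_right (hT.eigenvalues_antitone hN hji) (sq_nonneg _)

end CourantFischer

section LaplacianForm

variable {V : Type*} [Fintype V] [DecidableEq V] (G : SimpleGraph V) [DecidableRel G.Adj]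

theorem inner_toEuclideanLin_self (A : Matrix V V ℝ) (x : EuclideanSpace ℝ V) :
    inner ℝ x (toEuclideanLin A x) = x.ofLp ⬝ᵥ A *ᵥ x.ofLp := by
  rw [EuclideanSpace.inner_eq_star_dotProduct, dotProduct_comm]
  rfl

theorem lt_laplacianSecond_of_forall_pair (hV : 1 < Fintype.card V) {c : ℝ} (a b : V → ℝ)
    (h : ∀ α β : ℝ, (α ≠ 0 ∨ β ≠ 0) → c * ((α • a + β • b) ⬝ᵥ (α • a + β • b)) <
      (α • a + β • b) ⬝ᵥ G.lapMatrix ℝ *ᵥ (α • a + β • b)) :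
    c < laplacianSecond G hV := by
  have hsymm := isSymmetric_toEuclideanLin_iff.mpr (G.isHermitian_lapMatrix ℝ)
  have hlin : LinearIndependent ℝ ![WithLp.toLp 2 a, WithLp.toLp 2 b] := by
    refine LinearIndependent.pair_iff.2 fun α β h0 => ?_
    by_contra hne
    have hlt := h α β (not_and_or.1 hne)
    have h0' : α • a + β • b = 0 := congrArg WithLp.ofLp h0
    simp [h0'] at hlt
  obtain ⟨x, hxW, hx0, hle⟩ := exists_mem_inner_apply_self_le hsymm finrank_euclideanSpace
    (Submodule.span ℝ (Set.range ![WithLp.toLp 2 a, WithLp.toLp 2 b])) ⟨1, hV⟩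
    (by rw [finrank_span_eq_card hlin]; simp)
  rw [Matrix.range_cons, Matrix.range_cons, Matrix.range_empty, Set.union_empty] at hxW
  obtain ⟨α, β, rfl⟩ := Submodule.mem_span_pair.1 hxW
  have hne : α ≠ 0 ∨ β ≠ 0 := by
    by_contra! hαβ
    exact hx0 (by simp [hαβ])
  rw [inner_toEuclideanLin_self, EuclideanSpace.inner_eq_star_dotProduct] at hle
  exact lt_of_mul_lt_mul_right ((h α β hne).trans_le hle) (dotProduct_self_star_nonneg _)

theorem laplacianSecond_le_of_forall_dotProduct_eq_zero (hV : 1 < Fintype.card V) {c : ℝ}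
    (z : V → ℝ) (h : ∀ x : V → ℝ, z ⬝ᵥ x = 0 → x ⬝ᵥ G.lapMatrix ℝ *ᵥ x ≤ c * (x ⬝ᵥ x)) :
    laplacianSecond G hV ≤ c := by
  have hsymm := isSymmetric_toEuclideanLin_iff.mpr (G.isHermitian_lapMatrix ℝ)
  let w : EuclideanSpace ℝ V := WithLp.toLp 2 z
  have hrank : Fintype.card V ≤ finrank ℝ (ℝ ∙ w)ᗮ + 1 := by
    have hsum := (ℝ ∙ w).finrank_add_finrank_orthogonal
    have hone : finrank ℝ (ℝ ∙ w) ≤ 1 := by simpa using finrank_span_le_card (R := ℝ) {w}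
    rw [finrank_euclideanSpace] at hsum
    omega
  obtain ⟨x, hxW, hx0, hle⟩ := exists_mem_le_inner_apply_self hsymm finrank_euclideanSpace
    (ℝ ∙ w)ᗮ ⟨1, hV⟩ hrank
  have hzx : z ⬝ᵥ x.ofLp = 0 := by
    rw [dotProduct_comm]
    exact Submodule.mem_orthogonal_singleton_iff_inner_right.1 hxW
  have hpos : 0 < inner ℝ x x := real_inner_self_pos.2 hx0
  rw [inner_toEuclideanLin_self] at hle
  exact le_of_mul_le_mul_right (hle.trans (h x.ofLp hzx)) hpos

end LaplacianForm

section TestVectors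

variable {V : Type*} [Fintype V] [DecidableEq V] (G : SimpleGraph V) [DecidableRel G.Adj]

theorem quadraticForm_pos_of_discrim {p q r α β : ℝ} (hp : 0 < p) (hq : q ^ 2 < p * r)
    (hne : α ≠ 0 ∨ β ≠ 0) : 0 < p * α ^ 2 + 2 * q * (α * β) + r * β ^ 2 := by
  have hsq : p * (p * α ^ 2 + 2 * q * (α * β) + r * β ^ 2) =
      (p * α + q * β) ^ 2 + (p * r - q ^ 2) * β ^ 2 := by ring
  refine pos_of_mul_pos_right (a := p) ?_ hp.le
  rw [hsq]
  rcases eq_or_ne β 0 with rfl | hβ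
  · have hα : α ≠ 0 := by simpa using hne
    have : 0 < (p * α) ^ 2 := by positivity
    simpa using this
  · have := sub_pos.2 hq
    positivity

theorem lt_laplacianSecond_of_discrim (hV : 1 < Fintype.card V) {c : ℝ} (a b : V → ℝ)
    (ha : c * (a ⬝ᵥ a) < a ⬝ᵥ G.lapMatrix ℝ *ᵥ a)
    (hab : (a ⬝ᵥ G.lapMatrix ℝ *ᵥ b - c * (a ⬝ᵥ b)) ^ 2 <
      (a ⬝ᵥ G.lapMatrix ℝ *ᵥ a - c * (a ⬝ᵥ a)) * (b ⬝ᵥ G.lapMatrix ℝ *ᵥ b - c * (b ⬝ᵥ b))) :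
    c < laplacianSecond G hV := by
  refine lt_laplacianSecond_of_forall_pair G hV a b fun α β hne => ?_
  have hsymm : b ⬝ᵥ G.lapMatrix ℝ *ᵥ a = a ⬝ᵥ G.lapMatrix ℝ *ᵥ b := by
    rw [dotProduct_mulVec, ← mulVec_transpose, (G.isSymm_lapMatrix (R := ℝ)).eq, dotProduct_comm]
  have hpos := quadraticForm_pos_of_discrim (sub_pos.2 ha) hab hne
  simp only [mulVec_add, mulVec_smul, dotProduct_add, add_dotProduct, dotProduct_smul,
    smul_dotProduct, smul_eq_mul, hsymm, dotProduct_comm b a]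
  linarith

theorem lapMatrix_apply (i j : V) : G.lapMatrix ℝ i j =
    (if i = j then (G.degree i : ℝ) else 0) - if G.Adj i j then 1 else 0 := by
  simp [SimpleGraph.lapMatrix, SimpleGraph.degMatrix, diagonal_apply, SimpleGraph.adjMatrix_apply]

theorem le_laplacianSecond_of_not_adj (hV : 1 < Fintype.card V) {u v : V} (huv : u ≠ v)
    (hadj : ¬ G.Adj u v) {c : ℝ} (hu : c ≤ G.degree u) (hv : c ≤ G.degree v) :
    c ≤ laplacianSecond G hV := by
  refine le_of_forall_lt fun c' hc' => ?_
  have hu' := sub_pos.2 (hc'.trans_le hu)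
  have hv' := sub_pos.2 (hc'.trans_le hv)
  refine lt_laplacianSecond_of_discrim G hV (Pi.single u 1) (Pi.single v 1) ?_ ?_
  · simpa [lapMatrix_apply] using hu'
  · simpa [lapMatrix_apply, huv, hadj] using mul_pos hu' hv'

theorem lt_laplacianSecond_of_adj_of_adj_iff (hV : 1 < Fintype.card V) {v a b : V} (hva : v ≠ a)
    (hvb : v ≠ b) (hab : G.Adj a b) (hiff : G.Adj v a ↔ G.Adj v b) {c : ℝ} (hv : c < G.degree v)
    (hc : 2 * c < G.degree a + G.degree b + 2) : c < laplacianSecond G hV := by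
  set x : V → ℝ := Pi.single a 1 - Pi.single b 1 with hx
  have hform : x ⬝ᵥ G.lapMatrix ℝ *ᵥ x = G.degree a + G.degree b + 2 := by
    rw [hx, mulVec_sub, dotProduct_sub, sub_dotProduct, sub_dotProduct]
    simp only [single_one_dotProduct, mulVec_single_one, col_apply, lapMatrix_apply, hab,
      hab.symm, hab.ne, hab.ne', G.irrefl, if_true, if_false]
    ring
  have hnorm : x ⬝ᵥ x = 2 := by
    rw [hx, dotProduct_sub, sub_dotProduct, sub_dotProduct]
    simp only [single_one_dotProduct, Pi.single_eq_same, Pi.single_eq_of_ne, ne_eq, hab.ne,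
      hab.ne', not_false_eq_true]
    norm_num
  have hLv : (G.lapMatrix ℝ *ᵥ x) v = 0 := by
    simp [hx, mulVec_sub, lapMatrix_apply, hva, hvb, hiff]
  have hxv : x v = 0 := by simp [hx, hva, hvb]
  refine lt_laplacianSecond_of_discrim G hV (Pi.single v 1) x ?_ ?_
  · simpa [lapMatrix_apply] using hv
  · rw [single_one_dotProduct, single_one_dotProduct, hLv, hxv, hform, hnorm, mul_zero, sub_zero,
      zero_pow two_ne_zero]
    refine mul_pos ?_ (by linarith)
    simpa [lapMatrix_apply] using hv

theorem lt_laplacianSecond_of_isRegularOfDegree (hV : 1 < Fintype.card V) {k : ℕ}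
    (hreg : G.IsRegularOfDegree k) {a b c d : V} (hab : G.Adj a b) (hcd : G.Adj c d)
    (h : (G.adjMatrix ℝ a c - G.adjMatrix ℝ a d - (G.adjMatrix ℝ b c - G.adjMatrix ℝ b d)) ^ 2
      < 4) : k < laplacianSecond G hV := by
  have hform : ∀ x y : V → ℝ, x ⬝ᵥ G.lapMatrix ℝ *ᵥ y - k * (x ⬝ᵥ y) =
      -(x ⬝ᵥ G.adjMatrix ℝ *ᵥ y) := fun x y => by
    have hdeg : G.degMatrix ℝ = diagonal fun _ => (k : ℝ) := by
      simp only [SimpleGraph.degMatrix, hreg.degree_eq]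
    rw [SimpleGraph.lapMatrix, hdeg, sub_mulVec, dotProduct_sub, ← smul_one_eq_diagonal,
      smul_mulVec, one_mulVec, dotProduct_smul, smul_eq_mul]
    ring
  have hedge : ∀ {i j}, G.Adj i j → (Pi.single i 1 - Pi.single j 1) ⬝ᵥ
      G.adjMatrix ℝ *ᵥ (Pi.single i 1 - Pi.single j 1) = -2 := fun {i j} hij => by
    rw [mulVec_sub, dotProduct_sub, sub_dotProduct, sub_dotProduct]
    simp only [single_one_dotProduct, mulVec_single_one, col_apply, SimpleGraph.adjMatrix_apply,
      hij, hij.symm, G.irrefl, if_true, if_false]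
    norm_num
  refine lt_laplacianSecond_of_discrim G hV (Pi.single a 1 - Pi.single b 1)
    (Pi.single c 1 - Pi.single d 1) (sub_pos.1 ?_) ?_
  · rw [hform, hedge hab]
    norm_num
  · rw [hform, hform, hform, hedge hab, hedge hcd, neg_sq]
    convert h using 1
    · simp only [mulVec_sub, sub_dotProduct, dotProduct_sub, single_one_dotProduct,
        mulVec_single_one, col_apply]
      ring
    · norm_num

end TestVectors

section EdgeBounds

theorem two_mul_sum_sum_le_of_symm {ι : Type*} [Fintype ι] {g : ι → ι → ℝ}
    (hnonneg : ∀ i j, 0 ≤ g i j) (hsymm : ∀ i j, g i j = g j i) (U : Finset ι) :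
    2 * ∑ i ∈ U, ∑ j, g i j ≤ ∑ i, ∑ j, g i j + ∑ i ∈ U, ∑ j ∈ U, g i j := by
  classical
  have hcompl : ∑ i ∈ U, ∑ j ∈ Uᶜ, g i j ≤ ∑ i ∈ Uᶜ, ∑ j, g i j := by
    rw [sum_comm]
    refine sum_le_sum fun i _ => ?_
    simp only [hsymm _ i]
    exact sum_le_univ_sum_of_nonneg (hnonneg i)
  have hrow : ∑ i ∈ U, ∑ j, g i j = ∑ i ∈ U, ∑ j ∈ U, g i j + ∑ i ∈ U, ∑ j ∈ Uᶜ, g i j := by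
    rw [← sum_add_distrib]
    exact sum_congr rfl fun i _ => (sum_add_sum_compl U _).symm
  rw [← sum_add_sum_compl U fun i => ∑ j, g i j]
  linarith

variable {V : Type*} [Fintype V] [DecidableEq V] (G : SimpleGraph V) [DecidableRel G.Adj]

theorem sum_sum_neighborFinset_le (U : Finset V) (x : V → ℝ) :
    ∑ i ∈ U, ∑ t ∈ G.neighborFinset i, (x i - x t) ^ 2 ≤ x ⬝ᵥ G.lapMatrix ℝ *ᵥ x +
      (∑ i ∈ U, ∑ j ∈ U, if G.Adj i j then (x i - x j) ^ 2 else 0) / 2 := by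
  have h := two_mul_sum_sum_le_of_symm
    (g := fun i j => if G.Adj i j then (x i - x j) ^ 2 else 0)
    (fun i j => by split_ifs <;> positivity)
    (fun i j => by simp only [G.adj_comm i j, ← neg_sub (x i), neg_sq]) U
  rw [← toLinearMap₂'_apply', G.lapMatrix_toLinearMap₂' ℝ x]
  simp only [← sum_filter, ← G.neighborFinset_eq_filter] at h ⊢
  linarith

theorem sum_sq_sub_doubleStar_le {u v : V} (huv : G.Adj u v) {S S' : Finset V}
    (hS : S ⊆ (G.neighborFinset u).erase v) (hS' : S' ⊆ (G.neighborFinset v).erase u)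
    (x : V → ℝ) :
    (x u - x v) ^ 2 + ∑ t ∈ S, (x u - x t) ^ 2 + ∑ t ∈ S', (x v - x t) ^ 2 ≤
      x ⬝ᵥ G.lapMatrix ℝ *ᵥ x := by
  have hstar : ∀ {a b : V}, G.Adj a b → ∀ {R : Finset V}, R ⊆ (G.neighborFinset a).erase b →
      (x a - x b) ^ 2 + ∑ t ∈ R, (x a - x t) ^ 2 ≤
        ∑ t ∈ G.neighborFinset a, (x a - x t) ^ 2 := fun {a b} hab {R} hR => by
    rw [← add_sum_erase _ _ ((G.mem_neighborFinset a b).2 hab)]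
    gcongr
  have hu := hstar huv hS
  have hv := hstar huv.symm hS'
  have h := sum_sum_neighborFinset_le G {u, v} x
  simp only [sum_pair huv.ne, G.irrefl, huv, huv.symm, if_true, if_false] at h
  linarith [sq_nonneg (x u - x v), sub_sq_comm (x u) (x v)]

theorem dotProduct_self_eq_of_support {u v : V} {P : Finset V} (huv : u ≠ v) (huP : u ∉ P)
    (hvP : v ∉ P) {x : V → ℝ} {r : ℝ} (hP : ∀ t ∈ P, x t = r)
    (hsupp : ∀ t ∉ insert u (insert v P), x t = 0) :
    x ⬝ᵥ x = x u ^ 2 + x v ^ 2 + #P * r ^ 2 := by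
  rw [dotProduct, ← sum_subset (subset_univ _) fun t _ ht => by rw [hsupp t ht, zero_mul],
    sum_insert (by simp [huv, huP]), sum_insert hvP, sum_congr rfl fun t ht => by rw [hP t ht],
    sum_const, nsmul_eq_mul]
  ring

theorem le_laplacianSecond_of_doubleStar (hV : 1 < Fintype.card V) {u v : V} (huv : G.Adj u v)
    {s : ℕ} (hs : 1 ≤ s) {S S' : Finset V} (hS : S ⊆ (G.neighborFinset u).erase v)
    (hS' : S' ⊆ (G.neighborFinset v).erase u) (hcard : #S = s) (hcard' : #S' = s) :
    (s + 1 : ℝ) ≤ laplacianSecond G hV := by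
  -- The two leaf sets may overlap: this only decreases the norm of the test vectors.
  set P := S ∪ S' with hP
  have huP : u ∉ P := fun h => (mem_union.1 h).elim
    (fun h => by simpa using hS h) (fun h => by simpa using hS' h)
  have hvP : v ∉ P := fun h => (mem_union.1 h).elim
    (fun h => by simpa using hS h) (fun h => by simpa using hS' h)
  have hPcard : (#P : ℝ) ≤ 2 * s := by
    have : #P ≤ #S + #S' := card_union_le S S'
    exact_mod_cast (by omega : #P ≤ 2 * s)
  let a : V → ℝ := Pi.single u 1 - Pi.single v 1
  let b : V → ℝ := (s : ℝ) • (Pi.single u 1 + Pi.single v 1) - fun t => if t ∈ P then 1 else 0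
  refine le_of_forall_lt fun c hc => lt_laplacianSecond_of_forall_pair G hV a b fun α β hne => ?_
  set x := α • a + β • b with hx
  have hxu : x u = α + s * β := by simp [hx, a, b, huv.ne, huP, mul_comm]
  have hxv : x v = -α + s * β := by simp [hx, a, b, huv.ne', hvP, mul_comm]
  have hxP : ∀ t ∈ P, x t = -β := fun t ht => by
    simp [hx, a, b, ne_of_mem_of_not_mem ht huP, ne_of_mem_of_not_mem ht hvP, ht]
  have hnorm : x ⬝ᵥ x = 2 * α ^ 2 + (2 * s ^ 2 + #P) * β ^ 2 := by
    rw [dotProduct_self_eq_of_support huv.ne huP hvP hxP fun t ht => ?_, hxu, hxv]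
    · ring
    · simp only [mem_insert, not_or] at ht
      simp [hx, a, b, ht]
  have hpos : 0 < x ⬝ᵥ x := by
    rw [hnorm]
    rcases hne with h | h <;> positivity
  have hform := sum_sq_sub_doubleStar_le G huv hS hS' x
  have hsum : ∀ (r : ℝ), ∀ R ⊆ P, #R = s → ∑ t ∈ R, (r - x t) ^ 2 = s * (r + β) ^ 2 :=
    fun r R hR hRcard => by
      rw [sum_congr rfl fun t ht => by rw [hxP t (hR ht)], sum_const, hRcard, nsmul_eq_mul,
        sub_neg_eq_add]
  rw [hsum _ S subset_union_left hcard, hsum _ S' subset_union_right hcard', hxu, hxv] at hform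
  calc c * (x ⬝ᵥ x) < (s + 1) * (x ⬝ᵥ x) := mul_lt_mul_of_pos_right hc hpos
    _ ≤ (s + 1) * (2 * α ^ 2 + (2 * s ^ 2 + 2 * s) * β ^ 2) := by
      rw [hnorm]
      gcongr
    _ ≤ (2 * s + 4) * α ^ 2 + 2 * s * (s + 1) ^ 2 * β ^ 2 := by linarith [sq_nonneg α]
    _ ≤ x ⬝ᵥ G.lapMatrix ℝ *ᵥ x := by linarith

theorem le_laplacianSecond_of_adj (hV : 1 < Fintype.card V) {u v : V} (huv : G.Adj u v) {s : ℕ}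
    (hs : 1 ≤ s) (hu : s + 1 ≤ G.degree u) (hv : s + 1 ≤ G.degree v) :
    (s + 1 : ℝ) ≤ laplacianSecond G hV := by
  have herase : ∀ {i j}, G.Adj i j → s + 1 ≤ G.degree i → s ≤ #((G.neighborFinset i).erase j) :=
    fun {i j} hij hi => by
      rw [card_erase_of_mem ((G.mem_neighborFinset i j).2 hij), G.card_neighborFinset_eq_degree]
      omega
  obtain ⟨S, hS, hcard⟩ := exists_subset_card_eq (herase huv hu)
  obtain ⟨S', hS', hcard'⟩ := exists_subset_card_eq (herase huv.symm hv)
  exact le_laplacianSecond_of_doubleStar G hV huv hs hS hS' hcard hcard'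

theorem sq_lt_of_sq_le_mul {k h w p q : ℝ} (hk : 1 ≤ k) (h0 : 0 ≤ h) (hhk : h ≤ k) (hw1 : w ≤ 1)
    (hw : k < (k + 1) * w) (hp : w ≤ p) (hpq : w ^ 2 ≤ p * q) :
    h ^ 2 < p * ((k ^ 2 + k) * q + h) := by
  have hhw : h * (h - w) ≤ k * (k - w) := by
    have : 0 ≤ (k - h) * (k + h - w) := mul_nonneg (by linarith) (by linarith)
    linarith
  have hkw : k - w < (k + 1) * w ^ 2 := by nlinarith
  calc h ^ 2 = h * (h - w) + h * w := by ring
    _ ≤ k * (k - w) + h * w := by gcongr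
    _ < k * ((k + 1) * w ^ 2) + h * w := by gcongr
    _ ≤ k * ((k + 1) * (p * q)) + h * p := by gcongr
    _ = p * ((k ^ 2 + k) * q + h) := by ring

/- The discriminant inequality for the test vectors `e_v` and `L e_c`, where `Δ = deg v`,
`k = deg c`, `d` is the average degree and `h` counts the common neighbours of `v` and `c`. -/
theorem sq_lt_of_mul_sub_le {n k Δ d h : ℝ} (hk : 1 ≤ k) (hΔ : k + 1 ≤ Δ) (hn : Δ + 1 ≤ n)
    (h0 : 0 ≤ h) (hhk : h ≤ k) (hd : n * (d - k) ≤ Δ - k) :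
    h ^ 2 < (Δ - d) * ((k ^ 2 + k) * (k + 1 - d) + h) := by
  obtain ⟨e, he⟩ : ∃ e : ℝ, n * e = 1 := ⟨n⁻¹, mul_inv_cancel₀ (by linarith)⟩
  have he0 : 0 < e := by nlinarith
  have hdk : d - k ≤ (Δ - k) * e := by nlinarith
  have hΔe : (Δ + 1) * e ≤ 1 := by nlinarith
  have hw0 : 0 < 1 - e := by nlinarith
  have hΔd : (Δ - k) * (1 - e) ≤ Δ - d := by linarith
  have hgap : 1 - e ≤ (Δ - k) * (1 - (Δ - k) * e) := by
    have : 0 ≤ (Δ - k - 1) * (1 - (Δ - k + 1) * e) := mul_nonneg (by linarith) (by nlinarith)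
    linarith
  have hprod : (1 - e) ^ 2 ≤ (Δ - d) * (k + 1 - d) := by
    calc (1 - e) ^ 2 ≤ (1 - e) * ((Δ - k) * (1 - (Δ - k) * e)) := by
          rw [sq]
          gcongr
      _ = (Δ - k) * (1 - e) * (1 - (Δ - k) * e) := by ring
      _ ≤ (Δ - d) * (k + 1 - d) :=
          mul_le_mul hΔd (by linarith) (by nlinarith) (by nlinarith)
  exact sq_lt_of_sq_le_mul hk h0 hhk (by linarith) (by nlinarith) (by nlinarith) hprod

theorem lapMatrix_col_apply_self (c : V) : (G.lapMatrix ℝ).col c c = G.degree c := by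
  simp [lapMatrix_apply]

theorem lapMatrix_col_apply_of_adj {c t : V} (h : G.Adj c t) : (G.lapMatrix ℝ).col c t = -1 := by
  simp [lapMatrix_apply, h.ne', h.symm]

theorem lapMatrix_col_apply_of_not_adj {c t : V} (htc : t ≠ c) (h : ¬ G.Adj c t) :
    (G.lapMatrix ℝ).col c t = 0 := by
  simp [lapMatrix_apply, htc, G.adj_comm t c, h]

theorem lapMatrix_col_dotProduct_self (c : V) :
    (G.lapMatrix ℝ).col c ⬝ᵥ (G.lapMatrix ℝ).col c = (G.degree c : ℝ) ^ 2 + G.degree c := by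
  have hrow : (G.lapMatrix ℝ).col c = (G.lapMatrix ℝ) c :=
    funext fun t => (G.isSymm_lapMatrix (R := ℝ)).apply c t
  calc (G.lapMatrix ℝ).col c ⬝ᵥ (G.lapMatrix ℝ).col c
      = (G.lapMatrix ℝ *ᵥ (G.lapMatrix ℝ).col c) c := by rw [mulVec, ← hrow]
    _ = (G.degree c : ℝ) ^ 2 + G.degree c := by
      rw [G.lapMatrix_mulVec_apply, lapMatrix_col_apply_self, sum_congr rfl fun t ht =>
        lapMatrix_col_apply_of_adj G ((G.mem_neighborFinset c t).1 ht), sum_const,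
        G.card_neighborFinset_eq_degree, nsmul_eq_mul]
      ring

theorem lapMatrix_mulVec_col_apply {v c : V} (hvc : v ≠ c) (hadj : ¬ G.Adj v c) :
    (G.lapMatrix ℝ *ᵥ (G.lapMatrix ℝ).col c) v =
      #(G.neighborFinset v ∩ G.neighborFinset c) := by
  have hterm : ∀ t ∈ G.neighborFinset v, (G.lapMatrix ℝ).col c t =
      -if t ∈ G.neighborFinset c then 1 else 0 := fun t ht => by
    split_ifs with htc
    · exact lapMatrix_col_apply_of_adj G ((G.mem_neighborFinset c t).1 htc)
    · rw [neg_zero]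
      refine lapMatrix_col_apply_of_not_adj G ?_ (by simpa using htc)
      rintro rfl
      exact hadj ((G.mem_neighborFinset v t).1 ht)
  rw [G.lapMatrix_mulVec_apply, lapMatrix_col_apply_of_not_adj G hvc (hadj ∘ .symm), mul_zero,
    sum_congr rfl hterm, sum_neg_distrib, sum_ite_mem, sum_const, nsmul_one, zero_sub, neg_neg]

theorem le_lapMatrix_col_form {v c : V} (hvc : v ≠ c) (hadj : ¬ G.Adj v c) :
    (G.degree c : ℝ) * (G.degree c + 1) ^ 2 + #(G.neighborFinset v ∩ G.neighborFinset c) ≤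
      (G.lapMatrix ℝ).col c ⬝ᵥ G.lapMatrix ℝ *ᵥ (G.lapMatrix ℝ).col c := by
  set b := (G.lapMatrix ℝ).col c
  have hbc : b c = G.degree c := lapMatrix_col_apply_self G c
  have hbv : b v = 0 := lapMatrix_col_apply_of_not_adj G hvc (hadj ∘ .symm)
  have hbN : ∀ t ∈ G.neighborFinset c, b t = -1 := fun t ht =>
    lapMatrix_col_apply_of_adj G ((G.mem_neighborFinset c t).1 ht)
  have hc : ∑ t ∈ G.neighborFinset c, (b c - b t) ^ 2 = G.degree c * (G.degree c + 1) ^ 2 := by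
    rw [sum_congr rfl fun t ht => by rw [hbN t ht], hbc, sum_const,
      G.card_neighborFinset_eq_degree, nsmul_eq_mul, sub_neg_eq_add]
  have hv : (#(G.neighborFinset v ∩ G.neighborFinset c) : ℝ) ≤
      ∑ t ∈ G.neighborFinset v, (b v - b t) ^ 2 := by
    calc (#(G.neighborFinset v ∩ G.neighborFinset c) : ℝ)
        = ∑ t ∈ G.neighborFinset v ∩ G.neighborFinset c, (b v - b t) ^ 2 := by
          rw [sum_congr rfl fun t ht => by rw [hbN t (mem_of_mem_inter_right ht)], hbv]
          simp
      _ ≤ ∑ t ∈ G.neighborFinset v, (b v - b t) ^ 2 :=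
          sum_le_sum_of_subset_of_nonneg inter_subset_left fun _ _ _ => sq_nonneg _
  have h := sum_sum_neighborFinset_le G {c, v} b
  simp only [sum_pair hvc.symm, hadj, G.adj_comm c v, G.irrefl, if_false, add_zero,
    zero_div] at h
  linarith

theorem lt_laplacianSecond_of_card_mul_sub_le (hV : 1 < Fintype.card V) {v c : V}
    (hadj : ¬ G.Adj v c) (hc : 0 < G.degree c) (hcv : G.degree c < G.degree v) {d : ℝ}
    (hd : Fintype.card V * (d - G.degree c) ≤ G.degree v - G.degree c) :
    d < laplacianSecond G hV := by
  have hvc : v ≠ c := by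
    rintro rfl
    exact hcv.false
  have hk1 : (1 : ℝ) ≤ G.degree c := by exact_mod_cast hc
  have hkv : (G.degree c + 1 : ℝ) ≤ G.degree v := by exact_mod_cast hcv
  have hvn : (G.degree v + 1 : ℝ) ≤ Fintype.card V := by exact_mod_cast G.degree_lt_card_verts v
  have hcommon : (#(G.neighborFinset v ∩ G.neighborFinset c) : ℝ) ≤ G.degree c := by
    rw [← G.card_neighborFinset_eq_degree]
    exact_mod_cast card_le_card inter_subset_right
  have hdisc := sq_lt_of_mul_sub_le hk1 hkv hvn (Nat.cast_nonneg _) hcommon hd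
  have hdv : d < G.degree v := by nlinarith
  have hform := le_lapMatrix_col_form G hvc hadj
  have hvv : Pi.single v 1 ⬝ᵥ G.lapMatrix ℝ *ᵥ Pi.single v 1 -
      d * (Pi.single v 1 ⬝ᵥ Pi.single v 1) = G.degree v - d := by
    simp [lapMatrix_apply]
  refine lt_laplacianSecond_of_discrim G hV (Pi.single v 1) ((G.lapMatrix ℝ).col c) ?_ ?_
  · exact sub_pos.1 (hvv ▸ sub_pos.2 hdv)
  · rw [hvv, single_one_dotProduct, single_one_dotProduct, lapMatrix_mulVec_col_apply G hvc hadj,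
      lapMatrix_col_apply_of_not_adj G hvc (hadj ∘ .symm), lapMatrix_col_dotProduct_self, mul_zero,
      sub_zero]
    refine hdisc.trans_le (mul_le_mul_of_nonneg_left ?_ (by linarith))
    linarith

end EdgeBounds

/-- `G` is the complete bipartite graph with parts `A` and `Aᶜ`. -/
def IsCompleteBipartition {V : Type*} (G : SimpleGraph V) (A : Finset V) : Prop :=
  ∀ x y, G.Adj x y ↔ (x ∈ A ↔ y ∉ A)

section LargeDegrees

theorem exists_adj_ne_of_not_isVertexCover {V : Type*} {G : SimpleGraph V} {w : V}
    (h : ¬ G.IsVertexCover {w}) : ∃ x y, G.Adj x y ∧ x ≠ w ∧ y ≠ w := by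
  simpa [SimpleGraph.IsVertexCover, not_or] using h

theorem one_lt_degree_of_adj_of_adj {V : Type*} [Fintype V] (G : SimpleGraph V)
    [DecidableRel G.Adj] {u x y : V} (hxy : x ≠ y) (hx : G.Adj u x) (hy : G.Adj u y) :
    1 < G.degree u := by
  rw [← G.card_neighborFinset_eq_degree, one_lt_card]
  exact ⟨x, by simpa using hx, y, by simpa using hy, hxy⟩

variable {V : Type*} [Fintype V] [DecidableEq V] (G : SimpleGraph V) [DecidableRel G.Adj]

theorem one_le_laplacianSecond_of_adj_of_not_isVertexCover (hV : 1 < Fintype.card V) {u v : V}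
    (huv : G.Adj u v) (hcover : ¬ G.IsVertexCover {u}) : 1 ≤ laplacianSecond G hV := by
  obtain ⟨x, y, hxy, hxu, hyu⟩ := exists_adj_ne_of_not_isVertexCover hcover
  have hpos : ∀ {i j}, G.Adj i j → (1 : ℝ) ≤ G.degree i := fun {i j} hij => by
    exact_mod_cast (G.degree_pos_iff_exists_adj i).2 ⟨j, hij⟩
  by_cases hux : G.Adj u x
  · by_cases huy : G.Adj u y
    · have htwo := le_laplacianSecond_of_adj G hV hux le_rfl
        (one_lt_degree_of_adj_of_adj G hxy.ne hux huy)
        (one_lt_degree_of_adj_of_adj G hyu.symm hux.symm hxy)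
      rw [Nat.cast_one, one_add_one_eq_two] at htwo
      linarith
    · exact le_laplacianSecond_of_not_adj G hV hyu.symm huy (hpos huv) (hpos hxy.symm)
  · exact le_laplacianSecond_of_not_adj G hV hxu.symm hux (hpos huv) (hpos hxy)

theorem le_laplacianSecond_or_exists_isVertexCover (hV : 1 < Fintype.card V) {u v : V}
    (huv : u ≠ v) {k : ℕ} (hu : k ≤ G.degree u) (hv : k ≤ G.degree v) :
    k ≤ laplacianSecond G hV ∨ ∃ w, G.IsVertexCover {w} := by
  by_cases hadj : G.Adj u v
  · rcases le_or_gt k 1 with hk | hk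
    · by_cases hcover : G.IsVertexCover {u}
      · exact .inr ⟨u, hcover⟩
      · have hk' : (k : ℝ) ≤ 1 := by exact_mod_cast hk
        exact .inl (hk'.trans (one_le_laplacianSecond_of_adj_of_not_isVertexCover G hV hadj hcover))
    · obtain ⟨s, rfl⟩ : ∃ s, k = s + 1 := ⟨k - 1, by omega⟩
      exact .inl (by exact_mod_cast le_laplacianSecond_of_adj G hV hadj (by omega) hu hv)
  · exact .inl (le_laplacianSecond_of_not_adj G hV huv hadj (by exact_mod_cast hu)
      (by exact_mod_cast hv))

theorem exists_isCompleteBipartition_of_isRegularOfDegree {k : ℕ} (hk : 0 < k)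
    (hreg : G.IsRegularOfDegree k) [Nonempty V]
    (htri : ∀ a b c, G.Adj a b → G.Adj a c → ¬ G.Adj b c)
    (hdom : ∀ a b c, G.Adj a b → G.Adj a c ∨ G.Adj b c) :
    ∃ A : Finset V, #A = #Aᶜ ∧ IsCompleteBipartition G A := by
  have hcompl : ∀ {a b}, G.Adj a b → ∀ c, G.Adj b c ↔ ¬ G.Adj a c := fun {a b} hab c =>
    ⟨fun hbc hac => htri a b c hab hac hbc, (hdom a b c hab).resolve_left⟩
  obtain ⟨a⟩ := ‹Nonempty V›
  obtain ⟨b, hab⟩ := (G.degree_pos_iff_exists_adj a).1 (hreg a ▸ hk)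
  have hAc : (G.neighborFinset a)ᶜ = G.neighborFinset b := by
    ext c
    simp [hcompl hab c]
  refine ⟨G.neighborFinset a, ?_, fun x y => ?_⟩
  · rw [hAc, G.card_neighborFinset_eq_degree, G.card_neighborFinset_eq_degree, hreg a, hreg b]
  · simp only [G.mem_neighborFinset]
    by_cases hax : G.Adj a x
    · simp [hcompl hax y, hax]
    · have hbx : G.Adj b x := (hcompl hab x).2 hax
      simp [hcompl hbx y, hcompl hab y, hax]

theorem lt_laplacianSecond_or_exists_isCompleteBipartition (hV : 1 < Fintype.card V) {k : ℕ}
    (hk : 0 < k) (hreg : G.IsRegularOfDegree k) :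
    k < laplacianSecond G hV ∨ ∃ A : Finset V, #A = #Aᶜ ∧ IsCompleteBipartition G A := by
  refine or_iff_not_imp_left.2 fun hnot => ?_
  have : Nonempty V := Fintype.card_pos_iff.1 (by omega)
  refine exists_isCompleteBipartition_of_isRegularOfDegree G hk hreg
    (fun a b c hab hac hbc => hnot ?_) fun a b c hab => ?_
  · refine lt_laplacianSecond_of_isRegularOfDegree G hV hreg hab hac ?_
    norm_num [SimpleGraph.adjMatrix_apply, hac, hab.symm, hbc]
  · by_contra! hc
    obtain ⟨d, hcd⟩ := (G.degree_pos_iff_exists_adj c).1 (hreg c ▸ hk)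
    refine hnot (lt_laplacianSecond_of_isRegularOfDegree G hV hreg hab hcd ?_)
    simp only [SimpleGraph.adjMatrix_apply, hc.1, hc.2, if_false]
    split_ifs <;> norm_num

end LargeDegrees

section FullNeighbors

variable {V : Type*} [Fintype V] (G : SimpleGraph V) [DecidableRel G.Adj]

/-- The neighbors of `v` of degree `k`. When every vertex other than `v` has degree at most `k`,
these are the neighbors of `v` of largest possible degree. -/
def fullNeighbors (v : V) (k : ℕ) : Finset V :=
  {t ∈ G.neighborFinset v | G.degree t = k}

variable {G} {v : V} {k : ℕ}

theorem mem_fullNeighbors {c : V} : c ∈ fullNeighbors G v k ↔ G.Adj v c ∧ G.degree c = k := by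
  simp [fullNeighbors]

theorem fullNeighbors_subset : fullNeighbors G v k ⊆ G.neighborFinset v :=
  filter_subset _ _

variable [DecidableEq V]

theorem sum_card_neighborFinset_inter (T : Finset V) :
    ∑ c, #(G.neighborFinset c ∩ T) = ∑ t ∈ T, G.degree t := by
  have h := sum_card_bipartiteAbove_eq_sum_card_bipartiteBelow G.Adj (s := univ) (t := T)
  simpa [bipartiteAbove, bipartiteBelow, G.neighborFinset_eq_filter, filter_inter, G.adj_comm,
    ← G.card_neighborFinset_eq_degree] using h

theorem sum_card_neighborFinset_inter_fullNeighbors :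
    ∑ c ∈ univ.erase v, #(G.neighborFinset c ∩ fullNeighbors G v k) + #(fullNeighbors G v k) =
      #(fullNeighbors G v k) * k := by
  have hv : G.neighborFinset v ∩ fullNeighbors G v k = fullNeighbors G v k :=
    inter_eq_right.2 fullNeighbors_subset
  have hsum : ∑ t ∈ fullNeighbors G v k, G.degree t = #(fullNeighbors G v k) * k := by
    rw [sum_congr rfl fun t ht => (mem_fullNeighbors.1 ht).2, sum_const, smul_eq_mul]
  rw [← hsum, ← sum_card_neighborFinset_inter, ← sum_erase_add _ _ (mem_univ v), hv]

theorem sum_degree_eq_sum_erase_add :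
    ∑ c, G.degree c = ∑ c ∈ univ.erase v, (G.degree c +
      if c ∈ G.neighborFinset v \ fullNeighbors G v k then 1 else 0) + #(fullNeighbors G v k) := by
  have hv : univ.erase v ∩ (G.neighborFinset v \ fullNeighbors G v k) =
      G.neighborFinset v \ fullNeighbors G v k :=
    inter_eq_right.2 fun c hc => by
      simp only [mem_sdiff, G.mem_neighborFinset] at hc
      simpa using hc.1.ne'
  rw [sum_add_distrib, sum_ite_mem, hv, sum_const, smul_eq_mul, mul_one, add_assoc,
    card_sdiff_add_card_eq_card fullNeighbors_subset, G.card_neighborFinset_eq_degree,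
    sum_erase_add _ _ (mem_univ v)]

theorem card_neighborFinset_inter_fullNeighbors_lt {c : V}
    (h : G.Adj v c) : #(G.neighborFinset c ∩ fullNeighbors G v k) < G.degree c := by
  rw [← G.card_neighborFinset_eq_degree]
  refine card_lt_card (ssubset_of_subset_of_ne inter_subset_left fun heq => ?_)
  have hv : v ∈ G.neighborFinset c := (G.mem_neighborFinset c v).2 h.symm
  rw [← heq, mem_inter, mem_fullNeighbors] at hv
  exact G.loopless.irrefl v hv.2.1

theorem card_neighborFinset_inter_fullNeighbors_eq_zero {c : V}
    (h : ∀ t ∈ fullNeighbors G v k, ¬ G.Adj c t) :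
    #(G.neighborFinset c ∩ fullNeighbors G v k) = 0 := by
  rw [card_eq_zero, ← disjoint_iff_inter_eq_empty, disjoint_left]
  exact fun t hct ht => h t ht ((G.mem_neighborFinset c t).1 hct)

variable (hle : ∀ c, c ≠ v → G.degree c ≤ k) (hfar : ∀ c, c ≠ v → ¬ G.Adj v c → G.degree c < k)
  (hindep : ∀ s ∈ fullNeighbors G v k, ∀ t ∈ fullNeighbors G v k, ¬ G.Adj s t)

include hle

theorem degree_add_ite_mem_sdiff_fullNeighbors_le {c : V} (hcv : c ≠ v) :
    (G.degree c + if c ∈ G.neighborFinset v \ fullNeighbors G v k then 1 else 0) ≤ k := by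
  have hck := hle c hcv
  split_ifs with h
  · simp only [mem_sdiff, G.mem_neighborFinset, mem_fullNeighbors, not_and] at h
    exact hck.lt_of_ne (h.2 h.1)
  · exact hck

include hfar

theorem card_neighborFinset_inter_fullNeighbors_lt_of_ne {c : V} (hcv : c ≠ v) :
    #(G.neighborFinset c ∩ fullNeighbors G v k) < k := by
  by_cases hvc : G.Adj v c
  · exact (card_neighborFinset_inter_fullNeighbors_lt hvc).trans_le (hle c hcv)
  · refine lt_of_le_of_lt ?_ (hfar c hcv hvc)
    exact G.card_neighborFinset_eq_degree c ▸ card_le_card inter_subset_left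

include hindep

omit [DecidableEq V] in
theorem two_mul_card_fullNeighbors_lt (hk : 2 ≤ k) :
    2 * #(fullNeighbors G v k) < Fintype.card V := by
  classical
  have hcount := sum_card_neighborFinset_inter_fullNeighbors (G := G) (v := v) (k := k)
  have hV : 0 < Fintype.card V := Fintype.card_pos_iff.2 ⟨v⟩
  have hsub : fullNeighbors G v k ⊆ univ.erase v := fun t ht =>
    mem_erase.2 ⟨(mem_fullNeighbors.1 ht).1.ne', mem_univ t⟩
  have hcard := card_sdiff_add_card_eq_card hsub
  obtain ⟨l, rfl⟩ : ∃ l, k = l + 1 := ⟨k - 1, by omega⟩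
  set T := fullNeighbors G v (l + 1)
  have hterm : ∀ c ∈ univ.erase v,
      #(G.neighborFinset c ∩ T) ≤ if c ∈ univ.erase v \ T then l else 0 := fun c hc => by
    split_ifs with hcT
    · exact Nat.lt_succ_iff.1
        (card_neighborFinset_inter_fullNeighbors_lt_of_ne hle hfar (ne_of_mem_erase hc))
    · have hcT' : c ∈ T := by simpa [ne_of_mem_erase hc] using hcT
      exact (card_neighborFinset_inter_fullNeighbors_eq_zero (hindep c hcT')).le
  have hsum := sum_le_sum hterm
  rw [sum_ite_mem, inter_eq_right.2 sdiff_subset, sum_const, smul_eq_mul] at hsum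
  rw [card_erase_of_mem (mem_univ v), card_univ] at hcard
  have hmul : #T * l ≤ #(univ.erase v \ T) * l := by
    rw [mul_add, mul_one] at hcount
    omega
  have := Nat.le_of_mul_le_mul_right hmul (by omega)
  omega

omit [DecidableEq V] in
theorem two_mul_sum_degree_lt (hk : 2 ≤ k) :
    2 * ∑ c, G.degree c < 2 * (Fintype.card V * k) + Fintype.card V := by
  classical
  have hT := two_mul_card_fullNeighbors_lt hle hfar hindep hk
  have hsum := sum_le_card_nsmul (univ.erase v) _ k fun c hc =>
    degree_add_ite_mem_sdiff_fullNeighbors_le (k := k) hle (ne_of_mem_erase hc)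
  rw [card_erase_of_mem (mem_univ v), card_univ, smul_eq_mul] at hsum
  have := Nat.mul_le_mul_right k (Nat.sub_le (Fintype.card V) 1)
  rw [sum_degree_eq_sum_erase_add (v := v) (k := k)]
  omega

omit [DecidableEq V] in
theorem sum_degree_le_card_sub_one_mul (hk : 2 ≤ k)
    (hlow : ∀ t ∈ fullNeighbors G v k, ∀ c, G.Adj v c → G.Adj c t → G.degree c + 1 ≠ k) :
    ∑ c, G.degree c ≤ (Fintype.card V - 1) * k := by
  classical
  obtain ⟨l, rfl⟩ : ∃ l, k = l + 1 := ⟨k - 1, by omega⟩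
  have hcount := sum_card_neighborFinset_inter_fullNeighbors (G := G) (v := v) (k := l + 1)
  have hsplit := sum_degree_eq_sum_erase_add (G := G) (v := v) (k := l + 1)
  set T := fullNeighbors G v (l + 1)
  -- The edges into `T` compensate, with weight `l = k - 1`, for the excess of the degree sum.
  have hterm : ∀ c ∈ univ.erase v, #(G.neighborFinset c ∩ T) +
      l * (G.degree c + if c ∈ G.neighborFinset v \ T then 1 else 0) ≤ l * (l + 1) := fun c hc => by
    have hcv := ne_of_mem_erase hc
    rcases (degree_add_ite_mem_sdiff_fullNeighbors_le hle hcv).lt_or_eq with hlt | heq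
    · have hinter := card_neighborFinset_inter_fullNeighbors_lt_of_ne hle hfar hcv
      have := Nat.mul_le_mul_left l (Nat.lt_succ_iff.1 hlt)
      linarith [Nat.lt_succ_iff.1 hinter]
    · rw [heq, card_neighborFinset_inter_fullNeighbors_eq_zero, zero_add]
      intro t ht hct
      split_ifs at heq with hmem
      · simp only [mem_sdiff, G.mem_neighborFinset] at hmem
        exact hlow t ht c hmem.1 hct heq
      · have hvc : G.Adj v c := not_imp_comm.1 (hfar c hcv) heq.not_lt
        exact hindep c (mem_fullNeighbors.2 ⟨hvc, heq⟩) t ht hct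
  have hsum := sum_le_card_nsmul (univ.erase v) _ _ hterm
  rw [sum_add_distrib, ← mul_sum, card_erase_of_mem (mem_univ v), card_univ, smul_eq_mul] at hsum
  refine Nat.le_of_mul_le_mul_left ?_ (by omega : 0 < l)
  rw [hsplit]
  linarith

end FullNeighbors

section AverageDegree

/-- The average degree `2m / n` of a finite graph. -/
noncomputable def avgDegree {V : Type*} [Fintype V] [DecidableEq V] (G : SimpleGraph V)
    [DecidableRel G.Adj] : ℝ :=
  2 * #G.edgeFinset / Fintype.card V

variable {V : Type*} [Fintype V] [DecidableEq V] (G : SimpleGraph V) [DecidableRel G.Adj]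

theorem card_mul_avgDegree [Nonempty V] :
    Fintype.card V * avgDegree G = ∑ c, (G.degree c : ℝ) := by
  have hsum : (∑ c, G.degree c : ℝ) = 2 * #G.edgeFinset := by
    exact_mod_cast G.sum_degrees_eq_twice_card_edges
  rw [hsum, avgDegree, mul_div_cancel₀ _ (by positivity)]

theorem avgDegree_nonneg : 0 ≤ avgDegree G := by
  unfold avgDegree
  positivity

theorem avgDegree_eq_of_isRegularOfDegree [Nonempty V] {k : ℕ} (hreg : G.IsRegularOfDegree k) :
    avgDegree G = k := by
  have hcard := card_mul_avgDegree G
  simp only [hreg.degree_eq, sum_const, card_univ, nsmul_eq_mul] at hcard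
  exact mul_left_cancel₀ (by positivity) hcard

theorem exists_isRegularOfDegree_of_forall_degree_le [Nonempty V]
    (h : ∀ c, (G.degree c : ℝ) ≤ avgDegree G) : ∃ k, G.IsRegularOfDegree k := by
  have hsum : ∑ c, (G.degree c : ℝ) = ∑ _c : V, avgDegree G := by
    rw [← card_mul_avgDegree, sum_const, card_univ, nsmul_eq_mul]
  have heq := (sum_eq_sum_iff_of_le fun c _ => h c).1 hsum
  obtain ⟨v⟩ := ‹Nonempty V›
  exact ⟨G.degree v, fun c => by
    exact_mod_cast (heq c (mem_univ c)).trans (heq v (mem_univ v)).symm⟩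

theorem card_mul_avgDegree_sub_le {v : V} {k : ℕ} (hle : ∀ c, c ≠ v → G.degree c ≤ k) :
    Fintype.card V * (avgDegree G - k) ≤ G.degree v - k := by
  have : Nonempty V := ⟨v⟩
  have hsum : ∑ c ∈ univ.erase v, (G.degree c : ℝ) ≤ (Fintype.card V - 1) * k := by
    have h := sum_le_card_nsmul (univ.erase v) (fun c => (G.degree c : ℝ)) k fun c hc => by
      exact_mod_cast hle c (ne_of_mem_erase hc)
    rwa [card_erase_of_mem (mem_univ v), card_univ, nsmul_eq_mul,
      Nat.cast_pred Fintype.card_pos] at h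
  rw [mul_sub, card_mul_avgDegree, ← sum_erase_add _ _ (mem_univ v)]
  linarith

theorem two_mul_avgDegree_lt {v : V} {k : ℕ} (hk : 2 ≤ k) (hle : ∀ c, c ≠ v → G.degree c ≤ k)
    (hfar : ∀ c, c ≠ v → ¬ G.Adj v c → G.degree c < k)
    (hindep : ∀ s ∈ fullNeighbors G v k, ∀ t ∈ fullNeighbors G v k, ¬ G.Adj s t) :
    2 * avgDegree G < 2 * k + 1 := by
  have : Nonempty V := ⟨v⟩
  have hsum := card_mul_avgDegree G
  rw [← Nat.cast_sum] at hsum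
  have h : (2 * (∑ c, G.degree c : ℕ) : ℝ) < 2 * (Fintype.card V * k) + Fintype.card V := by
    exact_mod_cast two_mul_sum_degree_lt hle hfar hindep hk
  rw [← hsum] at h
  refine lt_of_mul_lt_mul_left (a := (Fintype.card V : ℝ)) ?_ (by positivity)
  linarith

theorem avgDegree_lt_of_fullNeighbors {v : V} {k : ℕ} (hk : 2 ≤ k)
    (hle : ∀ c, c ≠ v → G.degree c ≤ k) (hfar : ∀ c, c ≠ v → ¬ G.Adj v c → G.degree c < k)
    (hindep : ∀ s ∈ fullNeighbors G v k, ∀ t ∈ fullNeighbors G v k, ¬ G.Adj s t)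
    (hlow : ∀ t ∈ fullNeighbors G v k, ∀ c, G.Adj v c → G.Adj c t → G.degree c + 1 ≠ k) :
    avgDegree G < k := by
  have : Nonempty V := ⟨v⟩
  have hlt : (Fintype.card V - 1) * k < Fintype.card V * k :=
    Nat.mul_lt_mul_of_pos_right (Nat.pred_lt Fintype.card_ne_zero) (by omega)
  refine lt_of_mul_lt_mul_left (a := (Fintype.card V : ℝ)) ?_ (by positivity)
  rw [card_mul_avgDegree]
  exact_mod_cast (sum_degree_le_card_sub_one_mul hle hfar hindep hk hlow).trans_lt hlt

theorem avgDegree_lt_laplacianSecond_of_two_le (hV : 1 < Fintype.card V) {v : V} {k : ℕ}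
    (hk : 2 ≤ k) (hle : ∀ c, c ≠ v → G.degree c ≤ k) (hkavg : k ≤ avgDegree G)
    (havgk : avgDegree G < k + 1) (hv : avgDegree G < G.degree v) :
    avgDegree G < laplacianSecond G hV := by
  by_contra hnot
  have hfar : ∀ c, c ≠ v → ¬ G.Adj v c → G.degree c < k := fun c hcv hvc => by
    refine (hle c hcv).lt_of_ne fun hck => hnot ?_
    have hkv : k < G.degree v := by exact_mod_cast hkavg.trans_lt hv
    subst hck
    exact lt_laplacianSecond_of_card_mul_sub_le G hV hvc (by omega) hkv
      (card_mul_avgDegree_sub_le G hle)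
  have hedge : ∀ a b, G.Adj v a → G.Adj v b → G.Adj a b →
      (G.degree a + G.degree b + 2 : ℝ) ≤ 2 * avgDegree G := fun a b hva hvb hab =>
    not_lt.1 fun hlt => hnot <| lt_laplacianSecond_of_adj_of_adj_iff G hV hva.ne hvb.ne hab
      (iff_of_true hva hvb) hv hlt
  have hindep : ∀ s ∈ fullNeighbors G v k, ∀ t ∈ fullNeighbors G v k, ¬ G.Adj s t := by
    intro s hs t ht hst
    rw [mem_fullNeighbors] at hs ht
    have h := hedge s t hs.1 ht.1 hst
    rw [hs.2, ht.2] at h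
    linarith
  have hhalf := two_mul_avgDegree_lt G hk hle hfar hindep
  have hlow : ∀ t ∈ fullNeighbors G v k, ∀ c, G.Adj v c → G.Adj c t → G.degree c + 1 ≠ k := by
    intro t ht c hvc hct hck
    rw [mem_fullNeighbors] at ht
    have h := hedge c t hvc ht.1 hct
    rw [ht.2, ← hck] at h
    rw [← hck] at hhalf
    push_cast at h hhalf
    linarith
  exact hkavg.not_gt (avgDegree_lt_of_fullNeighbors G hk hle hfar hindep hlow)

theorem avgDegree_lt_laplacianSecond_of_unique (hV : 1 < Fintype.card V) {v : V}
    (hle : ∀ c, c ≠ v → G.degree c ≤ avgDegree G) (hv : avgDegree G < G.degree v)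
    (hcover : ¬ G.IsVertexCover {v}) : avgDegree G < laplacianSecond G hV := by
  have hk : ∀ c, c ≠ v → G.degree c ≤ ⌊avgDegree G⌋₊ := fun c hc => Nat.le_floor (hle c hc)
  have havg := Nat.lt_floor_add_one (avgDegree G)
  rcases le_or_gt 2 ⌊avgDegree G⌋₊ with h2 | h2
  · exact avgDegree_lt_laplacianSecond_of_two_le G hV h2 hk (Nat.floor_le (avgDegree_nonneg G))
      havg hv
  · obtain ⟨x, y, hxy, hxv, hyv⟩ := exists_adj_ne_of_not_isVertexCover hcover
    have hend : ∀ {a b}, G.Adj a b → a ≠ v → b ≠ v → ¬ G.Adj v a ∧ G.degree a = 1 := by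
      intro a b hab hav hbv
      have hpos := (G.degree_pos_iff_exists_adj a).2 ⟨b, hab⟩
      have hone := hk a hav
      refine ⟨fun hva => ?_, by omega⟩
      have := one_lt_degree_of_adj_of_adj G hbv.symm hva.symm hab
      omega
    obtain ⟨hvx, hx⟩ := hend hxy hxv hyv
    obtain ⟨hvy, hy⟩ := hend hxy.symm hyv hxv
    refine lt_laplacianSecond_of_adj_of_adj_iff G hV hxv.symm hyv.symm hxy
      (iff_of_false hvx hvy) hv ?_
    have : (⌊avgDegree G⌋₊ : ℝ) ≤ 1 := by exact_mod_cast Nat.lt_succ_iff.1 h2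
    rw [hx, hy, Nat.cast_one]
    linarith

theorem avgDegree_lt_laplacianSecond_or_exists (hV : 1 < Fintype.card V) :
    avgDegree G < laplacianSecond G hV ∨ (∃ A : Finset V, #A = #Aᶜ ∧ IsCompleteBipartition G A) ∨
      ∃ v, G.IsVertexCover {v} := by
  have : Nonempty V := Fintype.card_pos_iff.1 (by omega)
  by_cases hall : ∀ c, (G.degree c : ℝ) ≤ avgDegree G
  · obtain ⟨k, hreg⟩ := exists_isRegularOfDegree_of_forall_degree_le G hall
    rcases k.eq_zero_or_pos with rfl | hk
    · obtain ⟨v⟩ := this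
      exact .inr (.inr ⟨v, fun x y hxy =>
        absurd (hreg x) ((G.degree_pos_iff_exists_adj x).2 ⟨y, hxy⟩).ne'⟩)
    · rw [avgDegree_eq_of_isRegularOfDegree G hreg]
      exact (lt_laplacianSecond_or_exists_isCompleteBipartition G hV hk hreg).imp_right .inl
  push Not at hall
  obtain ⟨v, hv⟩ := hall
  by_cases huniq : ∀ c, c ≠ v → (G.degree c : ℝ) ≤ avgDegree G
  · by_cases hcover : G.IsVertexCover {v}
    · exact .inr (.inr ⟨v, hcover⟩)
    · exact .inl (avgDegree_lt_laplacianSecond_of_unique G hV huniq hv hcover)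
  · push Not at huniq
    obtain ⟨u, huv, hu⟩ := huniq
    refine (le_laplacianSecond_or_exists_isVertexCover G hV huv (k := min (G.degree u) (G.degree v))
      (min_le_left _ _) (min_le_right _ _)).imp (fun h => ?_) .inr
    exact (lt_min hu hv).trans_le (by exact_mod_cast h)

end AverageDegree

section ExtremalValues

theorem neighborFinset_subset_of_isVertexCover {V : Type*} [Fintype V] {G : SimpleGraph V}
    [DecidableRel G.Adj] {v c : V} (hcover : G.IsVertexCover {v}) (hcv : c ≠ v) :
    G.neighborFinset c ⊆ {v} := fun y hy => by
  have hmem := hcover ((G.mem_neighborFinset c y).1 hy)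
  simpa [hcv] using hmem

variable {V : Type*} [Fintype V] [DecidableEq V] (G : SimpleGraph V) [DecidableRel G.Adj]

theorem dotProduct_lapMatrix_mulVec_self (x : V → ℝ) :
    x ⬝ᵥ G.lapMatrix ℝ *ᵥ x =
      ∑ i, (G.degree i * x i ^ 2 - x i * ∑ j ∈ G.neighborFinset i, x j) := by
  refine sum_congr rfl fun i _ => ?_
  rw [G.lapMatrix_mulVec_apply]
  ring

section Star

variable {G} {v : V} (hcover : G.IsVertexCover {v})

include hcover

omit [DecidableEq V] in
theorem card_edgeFinset_of_isVertexCover : #G.edgeFinset = G.degree v := by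
  classical
  rw [← G.card_incidenceFinset_eq_degree, G.incidenceFinset_eq_filter, filter_true_of_mem]
  rintro ⟨x, y⟩ hxy
  have hmem := hcover (by simpa using hxy)
  simpa [eq_comm] using hmem

theorem avgDegree_of_isVertexCover : avgDegree G = 2 * G.degree v / Fintype.card V := by
  rw [avgDegree, card_edgeFinset_of_isVertexCover hcover]

theorem laplacianSecond_le_one_of_isVertexCover (hV : 1 < Fintype.card V) :
    laplacianSecond G hV ≤ 1 := by
  refine laplacianSecond_le_of_forall_dotProduct_eq_zero G hV (Pi.single v 1) fun x hx => ?_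
  have hxv : x v = 0 := by simpa using hx
  rw [dotProduct_lapMatrix_mulVec_self, one_mul]
  refine sum_le_sum fun i _ => ?_
  by_cases hiv : i = v
  · simp [hiv, hxv]
  · have hN := neighborFinset_subset_of_isVertexCover hcover hiv
    have hdeg : (G.degree i : ℝ) ≤ 1 := by
      rw [← G.card_neighborFinset_eq_degree]
      exact_mod_cast card_le_card hN
    have hzero : ∑ j ∈ G.neighborFinset i, x j = 0 := sum_eq_zero fun j hj => by
      rw [mem_singleton.1 (hN hj), hxv]
    rw [hzero, mul_zero, sub_zero, ← sq]
    exact mul_le_of_le_one_left (sq_nonneg _) hdeg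

theorem laplacianSecond_eq_one_of_isVertexCover (hV : 1 < Fintype.card V)
    (hdeg : 1 < G.degree v) : laplacianSecond G hV = 1 := by
  refine (laplacianSecond_le_one_of_isVertexCover hcover hV).antisymm ?_
  rw [← G.card_neighborFinset_eq_degree, one_lt_card] at hdeg
  obtain ⟨x, hx, y, hy, hxy⟩ := hdeg
  rw [G.mem_neighborFinset] at hx hy
  have hpos : ∀ {c}, G.Adj v c → (1 : ℝ) ≤ G.degree c := fun {c} hvc => by
    exact_mod_cast (G.degree_pos_iff_exists_adj c).2 ⟨v, hvc.symm⟩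
  refine le_laplacianSecond_of_not_adj G hV hxy (fun hadj => ?_) (hpos hx) (hpos hy)
  exact (hcover hadj).elim hx.ne' hy.ne'

end Star

section CompleteBipartition

variable {G} {A : Finset V} (hA : IsCompleteBipartition G A)

include hA

theorem neighborFinset_of_mem {i : V} (hi : i ∈ A) : G.neighborFinset i = Aᶜ := by
  ext j
  simp [hA i j, hi]

omit [DecidableEq V] in
theorem neighborFinset_of_not_mem {i : V} (hi : i ∉ A) : G.neighborFinset i = A := by
  classical
  ext j
  simp [hA i j, hi]

theorem isRegularOfDegree_of_isCompleteBipartition (hcard : #A = #Aᶜ) :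
    G.IsRegularOfDegree #A := fun i => by
  rw [← G.card_neighborFinset_eq_degree]
  by_cases hi : i ∈ A
  · rw [neighborFinset_of_mem hA hi, hcard]
  · rw [neighborFinset_of_not_mem hA hi]

theorem laplacianSecond_le_of_isCompleteBipartition (hV : 1 < Fintype.card V) :
    laplacianSecond G hV ≤ max #A #Aᶜ := by
  refine laplacianSecond_le_of_forall_dotProduct_eq_zero G hV (fun i => if i ∈ A then 1 else -1)
    fun x hx => ?_
  have hbalance : ∑ i ∈ Aᶜ, x i = ∑ i ∈ A, x i := by
    simp only [dotProduct, ite_mul, one_mul, neg_one_mul, sum_ite, filter_not, filter_univ_mem,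
      ← compl_eq_univ_sdiff, sum_neg_distrib] at hx
    linarith
  set S := ∑ i ∈ A, x i
  have hterm : ∀ i, G.degree i * x i ^ 2 - x i * ∑ j ∈ G.neighborFinset i, x j ≤
      max #A #Aᶜ * (x i * x i) - x i * S := fun i => by
    rw [← G.card_neighborFinset_eq_degree, ← sq]
    by_cases hi : i ∈ A
    · rw [neighborFinset_of_mem hA hi, hbalance]
      gcongr
      exact le_max_right _ _
    · rw [neighborFinset_of_not_mem hA hi]
      gcongr
      exact le_max_left _ _
  have htotal : ∑ i, x i = 2 * S := by
    rw [← sum_add_sum_compl A, hbalance, two_mul]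
  calc x ⬝ᵥ G.lapMatrix ℝ *ᵥ x ≤ ∑ i, (max #A #Aᶜ * (x i * x i) - x i * S) := by
        rw [dotProduct_lapMatrix_mulVec_self]
        exact sum_le_sum fun i _ => hterm i
    _ = max #A #Aᶜ * (x ⬝ᵥ x) - 2 * S ^ 2 := by
        rw [sum_sub_distrib, ← mul_sum, ← sum_mul, htotal, dotProduct]
        ring
    _ ≤ max #A #Aᶜ * (x ⬝ᵥ x) := by linarith [sq_nonneg S]

theorem laplacianSecond_eq_avgDegree_of_isCompleteBipartition (hV : 2 < Fintype.card V)
    (hcard : #A = #Aᶜ) : laplacianSecond G (by omega) = avgDegree G := by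
  have hreg := isRegularOfDegree_of_isCompleteBipartition hA hcard
  have hA1 : 1 < #A := by
    have := card_add_card_compl A
    omega
  obtain ⟨a, ha, b, hb, hab⟩ := one_lt_card.1 hA1
  have : Nonempty V := ⟨a⟩
  rw [avgDegree_eq_of_isRegularOfDegree G hreg]
  refine le_antisymm ?_ (le_laplacianSecond_of_not_adj G (by omega) hab (by simp [hA a b, ha, hb])
    (by rw [hreg a]) (by rw [hreg b]))
  simpa [← hcard] using laplacianSecond_le_of_isCompleteBipartition hA (by omega)

end CompleteBipartition

theorem laplacianSecond_bot (hV : 1 < Fintype.card V) (hG : G = ⊥) :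
    laplacianSecond G hV = 0 := by
  subst hG
  obtain ⟨a, b, hab⟩ := Fintype.one_lt_card_iff.1 hV
  refine le_antisymm ?_ (le_laplacianSecond_of_not_adj _ hV hab (by simp) (by simp) (by simp))
  refine laplacianSecond_le_of_forall_dotProduct_eq_zero _ hV 0 fun x _ => ?_
  rw [dotProduct_lapMatrix_mulVec_self]
  simp

/-- The graphs for which the second Laplacian eigenvalue equals the average degree: the edgeless
graph, `K_{n/2,n/2}`, and the star with `n/2` leaves together with isolated vertices. A star is
recognised by a single vertex covering all edges. -/
def IsExtremal : Prop :=
  G = ⊥ ∨ (∃ A : Finset V, #A = #Aᶜ ∧ IsCompleteBipartition G A) ∨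
    ∃ v, G.IsVertexCover {v} ∧ 2 * G.degree v = Fintype.card V

theorem laplacianSecond_eq_avgDegree_of_isExtremal (hV : 2 < Fintype.card V) (h : IsExtremal G) :
    laplacianSecond G (by omega) = avgDegree G := by
  rcases h with hbot | ⟨A, hcard, hA⟩ | ⟨v, hcover, hdeg⟩
  · have hG : #G.edgeFinset = 0 := by simpa using hbot
    rw [laplacianSecond_bot G _ hbot, avgDegree, hG]
    simp
  · exact laplacianSecond_eq_avgDegree_of_isCompleteBipartition hA hV hcard
  · have hpos : (Fintype.card V : ℝ) ≠ 0 := by positivity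
    rw [laplacianSecond_eq_one_of_isVertexCover hcover _ (by omega),
      avgDegree_of_isVertexCover hcover, eq_comm, div_eq_one_iff_eq hpos]
    exact_mod_cast hdeg

theorem avgDegree_lt_laplacianSecond_or_isExtremal (hV : 1 < Fintype.card V)
    (hstar : ∀ v, G.IsVertexCover {v} → G.degree v ≠ 1 ∧ 2 * G.degree v ≤ Fintype.card V) :
    avgDegree G < laplacianSecond G hV ∨ IsExtremal G := by
  rcases avgDegree_lt_laplacianSecond_or_exists G hV with hlt | hA | ⟨v, hcover⟩
  · exact .inl hlt
  · exact .inr (.inr (.inl hA))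
  obtain ⟨hone, hhalf⟩ := hstar v hcover
  rcases Nat.eq_zero_or_pos (G.degree v) with hzero | hpos
  · have hG : #G.edgeFinset = 0 := (card_edgeFinset_of_isVertexCover hcover).trans hzero
    exact .inr (.inl (by simpa using hG))
  rcases hhalf.lt_or_eq with hlt | heq
  · left
    rw [laplacianSecond_eq_one_of_isVertexCover hcover hV (by omega),
      avgDegree_of_isVertexCover hcover, div_lt_one (by positivity)]
    exact_mod_cast hlt
  · exact .inr (.inr (.inr ⟨v, hcover, heq⟩))

end ExtremalValues

section Recognition

theorem exists_equiv_mem_iff_mem {V W : Type*} [Fintype V] [Fintype W] {A : Finset V}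
    {B : Finset W} (hVW : Fintype.card V = Fintype.card W) (hAB : #A = #B) :
    ∃ e : V ≃ W, ∀ x, e x ∈ B ↔ x ∈ A := by
  classical
  let e := Fintype.equivOfCardEq hVW
  have hcard : #(A.map e.toEmbedding) = #B := by rw [card_map, hAB]
  let f : {y // y ∈ A.map e.toEmbedding} ≃ {y // y ∈ B} := Finset.equivOfCardEq hcard
  refine ⟨e.trans f.extendSubtype, fun x => ⟨fun h => ?_, fun h => ?_⟩⟩
  · by_contra hx
    exact f.extendSubtype_not_mem (e x) (by simpa using hx) h
  · exact f.extendSubtype_mem (e x) (by simpa using h)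

variable {V W : Type*} [Fintype V] [Fintype W] {G : SimpleGraph V} {H : SimpleGraph W}

theorem nonempty_iso_of_isCompleteBipartition {A : Finset V} {B : Finset W}
    (hVW : Fintype.card V = Fintype.card W) (hAB : #A = #B) (hA : IsCompleteBipartition G A)
    (hB : IsCompleteBipartition H B) : Nonempty (G ≃g H) := by
  obtain ⟨e, he⟩ := exists_equiv_mem_iff_mem hVW hAB
  exact ⟨⟨e, fun {x y} => by rw [hA x y, hB, he, he]⟩⟩

theorem isCompleteBipartition_completeBipartiteGraph (V W : Type*) [Fintype V] :
    IsCompleteBipartition (completeBipartiteGraph V W) (univ.map Function.Embedding.inl) := by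
  rintro (x | x) (y | y) <;> simp

theorem nonempty_iso_completeBipartiteGraph_iff [DecidableEq V] {a b : ℕ} :
    Nonempty (G ≃g completeBipartiteGraph (Fin a) (Fin b)) ↔
      ∃ A : Finset V, #A = a ∧ #Aᶜ = b ∧ IsCompleteBipartition G A := by
  have hH := isCompleteBipartition_completeBipartiteGraph (Fin a) (Fin b)
  have hcard : #((univ : Finset (Fin a)).map (Function.Embedding.inl (β := Fin b))) = a := by simp
  constructor
  · rintro ⟨φ⟩
    have hV : Fintype.card V = a + b := by simp [φ.card_eq]
    set A := (univ.map Function.Embedding.inl).map φ.symm.toEquiv.toEmbedding with hAdef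
    have hA : #A = a := by rw [card_map, hcard]
    refine ⟨A, hA, by rw [card_compl]; omega, fun x y => ?_⟩
    have hmem : ∀ x, x ∈ A ↔ φ x ∈ univ.map Function.Embedding.inl := fun x => by
      rw [hAdef, mem_map_equiv]
      rfl
    rw [← φ.map_adj_iff, hH, hmem, hmem]
  · rintro ⟨A, hAa, hAb, hA⟩
    refine nonempty_iso_of_isCompleteBipartition ?_ (hAa.trans hcard.symm) hA hH
    rw [← card_add_card_compl A, hAa, hAb]
    simp

section Star

variable [DecidableRel G.Adj]

theorem adj_iff_of_isVertexCover {v : V} (hcover : G.IsVertexCover {v}) (x y : V) :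
    G.Adj x y ↔ x = v ∧ y ∈ G.neighborFinset v ∨ y = v ∧ x ∈ G.neighborFinset v := by
  simp only [G.mem_neighborFinset]
  refine ⟨fun hxy => ?_, ?_⟩
  · rcases hcover hxy with rfl | rfl
    · exact .inl ⟨rfl, hxy⟩
    · exact .inr ⟨rfl, hxy.symm⟩
  · rintro (⟨rfl, h⟩ | ⟨rfl, h⟩)
    exacts [h, h.symm]

theorem nonempty_iso_of_isVertexCover [DecidableRel H.Adj] {v : V} {w : W}
    (hVW : Fintype.card V = Fintype.card W) (hv : G.IsVertexCover {v}) (hw : H.IsVertexCover {w})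
    (hdeg : G.degree v = H.degree w) : Nonempty (G ≃g H) := by
  classical
  obtain ⟨e, he⟩ := exists_equiv_mem_iff_mem (A := G.neighborFinset v) (B := H.neighborFinset w)
    hVW (by simpa using hdeg)
  let σ := e.trans (Equiv.swap (e v) w)
  have hσv : ∀ x, σ x = w ↔ x = v := fun x => by
    rw [← Equiv.swap_apply_left (e v) w]
    exact σ.injective.eq_iff (b := v)
  have hσN : ∀ x, σ x ∈ H.neighborFinset w ↔ x ∈ G.neighborFinset v := fun x => by
    have hev : e v ∉ H.neighborFinset w := by simp [he]
    rw [← he, Equiv.trans_apply, Equiv.swap_apply_def]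
    split_ifs with h1 h2
    · simp [h1, hev]
    · simp [h2, hev]
    · rfl
  exact ⟨⟨σ, fun {x y} => by
    rw [adj_iff_of_isVertexCover hv, adj_iff_of_isVertexCover hw, hσv, hσv, hσN, hσN]⟩⟩

theorem isVertexCover_starUnionIsolated (s r : ℕ) :
    (starUnionIsolated s r).IsVertexCover {Sum.inl (Sum.inl 0)} := by
  rintro ((x | x) | x) ((y | y) | y) <;> simp [eq_iff_true_of_subsingleton]

theorem degree_starUnionIsolated (s r : ℕ)
    [Fintype ((starUnionIsolated s r).neighborSet (Sum.inl (Sum.inl 0)))] :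
    (starUnionIsolated s r).degree (Sum.inl (Sum.inl 0)) = s := by
  have hN : (starUnionIsolated s r).neighborFinset (Sum.inl (Sum.inl 0)) =
      univ.map (Function.Embedding.inr.trans Function.Embedding.inl) := by
    ext ((x | x) | x) <;> simp
  rw [← SimpleGraph.card_neighborFinset_eq_degree, hN, card_map, card_univ, Fintype.card_fin]

theorem nonempty_iso_starUnionIsolated_iff {s r : ℕ} :
    Nonempty (G ≃g starUnionIsolated s r) ↔
      s + r + 1 = Fintype.card V ∧ ∃ v, G.IsVertexCover {v} ∧ G.degree v = s := by
  classical
  have hcard : Fintype.card ((Fin 1 ⊕ Fin s) ⊕ Fin r) = s + r + 1 := by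
    simp only [Fintype.card_sum, Fintype.card_fin]
    omega
  constructor
  · rintro ⟨φ⟩
    refine ⟨hcard.symm.trans φ.card_eq.symm, φ.symm (Sum.inl (Sum.inl 0)), ?_, ?_⟩
    · rw [← Set.image_singleton, SimpleGraph.isVertexCover_image_iso]
      exact isVertexCover_starUnionIsolated s r
    · rw [φ.symm.degree_eq, degree_starUnionIsolated]
  · rintro ⟨hV, v, hcover, hdeg⟩
    exact nonempty_iso_of_isVertexCover (hV.symm.trans hcard.symm) hcover
      (isVertexCover_starUnionIsolated s r) (by rw [hdeg, degree_starUnionIsolated])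

end Star

theorem nonempty_iso_bot_iff {n : ℕ} (hn : Fintype.card V = n) :
    Nonempty (G ≃g (⊥ : SimpleGraph (Fin n))) ↔ G = ⊥ := by
  constructor
  · rintro ⟨φ⟩
    ext x y
    rw [← φ.map_adj_iff]
    simp
  · rintro rfl
    exact ⟨⟨Fintype.equivFinOfCardEq hn, by simp⟩⟩

variable [DecidableRel G.Adj]

theorem isExtremal_iff_nonempty_iso [DecidableEq V] {n : ℕ} (hn : Fintype.card V = n)
    (hn0 : 0 < n) :
    IsExtremal G ↔ Nonempty (G ≃g (⊥ : SimpleGraph (Fin n))) ∨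
      (Even n ∧ Nonempty (G ≃g completeBipartiteGraph (Fin (n / 2)) (Fin (n / 2)))) ∨
      (Even n ∧ Nonempty (G ≃g starUnionIsolated (n / 2) (n / 2 - 1))) := by
  rw [IsExtremal, nonempty_iso_bot_iff hn, nonempty_iso_completeBipartiteGraph_iff,
    nonempty_iso_starUnionIsolated_iff, even_iff_two_dvd]
  refine or_congr_right (or_congr ⟨?_, ?_⟩ ⟨?_, ?_⟩)
  · rintro ⟨A, hcard, hA⟩
    have := card_add_card_compl A
    exact ⟨by omega, A, by omega, by omega, hA⟩
  · rintro ⟨-, A, h, h', hA⟩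
    exact ⟨A, h.trans h'.symm, hA⟩
  · rintro ⟨v, hcover, hdeg⟩
    exact ⟨by omega, by omega, v, hcover, by omega⟩
  · rintro ⟨heven, -, v, hcover, hdeg⟩
    exact ⟨v, hcover, by omega⟩

theorem le_ceil_half_sub_two {n r : ℕ} (h : 2 * r + 2 < n) : (r : ℤ) ≤ ⌈(n : ℚ) / 2⌉ - 2 := by
  have hlt : ((r + 1 : ℤ) : ℚ) < n / 2 := by
    rw [lt_div_iff₀ two_pos]
    push_cast
    exact_mod_cast (by omega : (r + 1) * 2 < n)
  have := Int.lt_ceil.2 hlt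
  omega

theorem degree_ne_one_and_two_mul_degree_le {n : ℕ} (hn : Fintype.card V = n)
    (hG : ∀ r : ℕ, ((r : ℤ) ≤ ⌈(n : ℚ) / 2⌉ - 2 ∨ r = n - 2) →
      ¬ Nonempty (G ≃g starUnionIsolated (n - r - 1) r)) {v : V} (hcover : G.IsVertexCover {v}) :
    G.degree v ≠ 1 ∧ 2 * G.degree v ≤ n := by
  have hlt := hn ▸ G.degree_lt_card_verts v
  obtain ⟨r, hr⟩ : ∃ r, r + G.degree v + 1 = n := ⟨n - G.degree v - 1, by omega⟩
  have hiso : Nonempty (G ≃g starUnionIsolated (n - r - 1) r) :=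
    nonempty_iso_starUnionIsolated_iff.2 ⟨by omega, v, hcover, by omega⟩
  refine ⟨fun hone => hG r (.inr (by omega)) hiso, ?_⟩
  by_contra! hhalf
  exact hG r (.inl (le_ceil_half_sub_two (by omega))) hiso

end Recognition

theorem theorem3p5 {V : Type*} [Fintype V] [DecidableEq V]
    (G : SimpleGraph V) [DecidableRel G.Adj] (n m : ℕ)
    (hn : Fintype.card V = n) (hn2 : 2 < n) (hm : G.edgeFinset.card = m)
    (hG : ∀ r : ℕ, ((r : ℤ) ≤ ⌈(n : ℚ) / 2⌉ - 2 ∨ r = n - 2) →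
      ¬ Nonempty (G ≃g starUnionIsolated (n - r - 1) r)) :
    2 * (m : ℝ) / n ≤ laplacianSecond G (by omega) ∧
    (laplacianSecond G (by omega) = 2 * (m : ℝ) / n ↔
      Nonempty (G ≃g (⊥ : SimpleGraph (Fin n))) ∨
      (Even n ∧ Nonempty (G ≃g completeBipartiteGraph (Fin (n / 2)) (Fin (n / 2)))) ∨
      (Even n ∧ Nonempty (G ≃g starUnionIsolated (n / 2) (n / 2 - 1)))) := by
  subst hm
  have havg : 2 * (#G.edgeFinset : ℝ) / n = avgDegree G := by rw [avgDegree, hn]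
  have hlt := avgDegree_lt_laplacianSecond_or_isExtremal G (by omega) fun v hcover =>
    hn.symm ▸ degree_ne_one_and_two_mul_degree_le hn hG hcover
  have heq := laplacianSecond_eq_avgDegree_of_isExtremal G (by omega)
  rw [havg, ← isExtremal_iff_nonempty_iso hn (by omega)]
  exact ⟨hlt.elim le_of_lt fun h => (heq h).ge, fun h => hlt.resolve_left h.not_gt, heq⟩
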